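/- Let $p\in[1,\infty)$ and let $I\subseteq\mathbb{R}$ be an interval, bounded or unbounded. For $\varphi\colon I\to\mathbb{R}$ that is integrable over every bounded subinterval of $I$ (that is, $\varphi\in L_1(I)$ if $I$ is bounded and $\varphi\in L_{1,\mathrm{loc}}(\mathbb{R})$ if $I=\mathbb{R}$), put $$\|\varphi\|_{p,I}=\sup_{J}\Big(\frac1{|J|}\int_J|\varphi(x)-\langle\varphi\rangle_J|^p\,dx\Big)^{1/p}\in[0,\infty],\qquad \langle\varphi\rangle_J=\frac1{|J|}\int_J\varphi(x)\,dx,$$ where $J$ runs through all bounded intervals of positive length contained in $I$. For $g\colon\mathbb{R}\to\mathbb{R}$ put $$\|g\|_{\mathrm{Lip}}=\sup_{x\ne y}\frac{|g(x)-g(y)|}{|x-y|}\in[0,\infty].$$ (i) If $g\colon\mathbb{R}\to\mathbb{R}$ is non-decreasing, then $$\|g(\varphi)\|_{p,I}\le\|g\|_{\mathrm{Lip}}\,\|\varphi\|_{p,I}$$ (with $0\cdot\infty=\infty\cdot0=0$). If $\|g\|_{\mathrm{Lip}}<\infty$, then $g(\varphi)$ is again integrable over every bounded subinterval of $I$. If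 $\|g\|_{\mathrm{Lip}}=\infty$ and $\|\varphi\|_{p,I}>0$, the right-hand side is $\infty$ and the inequality is void. (ii) For every $N\in\mathbb{R}$, the truncation $\min(\varphi,N)$ is integrable over every bounded subinterval of $I$, and $$\|\min(\varphi,N)\|_{p,I}\le\|\varphi\|_{p,I}.$$ -/

import Mathlib

open MeasureTheory Set
open scoped ENNReal

noncomputable section

/-- The bounded intervals `J ⊆ I` of positive length (open, closed or half-open). -/
def boundedSubintervals (I : Set ℝ) : Set (Set ℝ) :=
  {J | J ⊆ I ∧ J.OrdConnected ∧ Bornology.IsBounded J ∧ J.Nontrivial}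

/-- `φ` is integrable over every bounded subinterval of `I`. For a bounded interval `I` this says
that `φ` is integrable on `I`, for `I = ℝ` that `φ` is locally integrable. -/
def IntegrableOnSubintervals (φ : ℝ → ℝ) (I : Set ℝ) : Prop :=
  ∀ J ∈ boundedSubintervals I, IntegrableOn φ J volume

/-- The `p`-mean oscillation `(|J|⁻¹ ∫_J |φ - ⟨φ⟩_J|^p)^(1/p)`, as an extended nonnegative real,
where `⟨φ⟩_J` is the average of `φ` over `J`. -/
def meanOsc (p : ℝ) (φ : ℝ → ℝ) (J : Set ℝ) : ℝ≥0∞ :=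
  ((volume J)⁻¹ * ∫⁻ x in J, ENNReal.ofReal (|φ x - ⨍ y in J, φ y| ^ p)) ^ (1 / p)

/-- The seminorm `‖φ‖_{p,I}` of `BMO_p(I)`, with values in `[0, ∞]`. -/
def bmoNorm (p : ℝ) (I : Set ℝ) (φ : ℝ → ℝ) : ℝ≥0∞ :=
  ⨆ J ∈ boundedSubintervals I, meanOsc p φ J

/-- The Lipschitz constant `sup_{x ≠ y} |g x - g y| / |x - y|`, with values in `[0, ∞]`. -/
def lipConst (g : ℝ → ℝ) : ℝ≥0∞ :=
  ⨆ (x : ℝ) (y : ℝ) (_ : x ≠ y), ENNReal.ofReal (|g x - g y| / |x - y|)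

end

/-! Put `L = lipConst g`. Both `g` and `h x = L * x - g x` are non-decreasing, so on `J` the
function `L * (φ - ⟨φ⟩)` is a sum of two centred functions moving in the same direction: `g(φ) -
⟨g(φ)⟩` and `Z = h(φ) - ⟨h(φ)⟩`. Adding `Z` does not lower the mean of a convex `f`: by
comonotonicity a single slope `s` gives `f(u + Z) ≥ f(u) + s * Z` pointwise, and `Z` has mean zero
(`lintegral_convex_comp_sub_average_le`). Taking `f t = |t| ^ p` gives (i) when `L` is finite; (ii)
is the case `g x = min x N`, where `L ≤ 1`. -/

/-- If `z` has the sign of `u - u₀`, the increment `f (u + z) - f u` of a convex function is at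
least `s * z`, where `s` depends only on `u₀`. -/
theorem ConvexOn.exists_slope_le_increment {f : ℝ → ℝ} (hf : ConvexOn ℝ univ f) (u₀ : ℝ) :
    ∃ s : ℝ, ∀ u z : ℝ, (0 < z → u₀ ≤ u) → (z < 0 → u ≤ u₀) → f u + s * z ≤ f (u + z) := by
  have hmono : MonotoneOn (fun x => derivWithin f (Ioi x) x) univ := by
    simpa using hf.monotoneOn_rightDeriv
  have hright : ∀ u z : ℝ, 0 < z → derivWithin f (Ioi u) u * z ≤ f (u + z) - f u := by
    intro u z hz
    have h := hf.rightDeriv_le_slope_of_mem_interior (x := u) (y := u + z) (by simp) (mem_univ _)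
      (by linarith)
    rw [slope_def_field, add_sub_cancel_left, le_div_iff₀ hz] at h
    exact h
  have hleft : ∀ u z : ℝ, z < 0 → derivWithin f (Ioi u) u * z ≤ f (u + z) - f u := by
    intro u z hz
    have h := (hf.slope_le_leftDeriv_of_mem_interior (x := u + z) (y := u) (mem_univ _) (by simp)
      (by linarith)).trans (hf.leftDeriv_le_rightDeriv_of_mem_interior (x := u) (by simp))
    rw [slope_def_field, div_le_iff₀ (by linarith)] at h
    linarith
  -- The right derivative is monotone and `u` lies on the side of `u₀` given by the sign of `z`, so
  -- replacing the slope at `u` by the one at `u₀` can only lower the product with `z`.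
  refine ⟨derivWithin f (Ioi u₀) u₀, fun u z hpos hneg => ?_⟩
  rcases lt_trichotomy z 0 with hz | rfl | hz
  · have h₁ := hleft u z hz
    have h₂ := mul_le_mul_of_nonpos_right (hmono (mem_univ _) (mem_univ _) (hneg hz)) hz.le
    simp only at h₂
    linarith
  · simp
  · have h₁ := hright u z hz
    have h₂ := mul_le_mul_of_nonneg_right (hmono (mem_univ _) (mem_univ _) (hpos hz)) hz.le
    simp only at h₂
    linarith

theorem convexOn_abs_rpow {p : ℝ} (hp : 1 ≤ p) : ConvexOn ℝ univ fun t : ℝ => |t| ^ p := by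
  have habs : ConvexOn ℝ univ fun t : ℝ => |t| := convexOn_univ_norm
  refine ⟨convex_univ, fun x _ y _ a b ha hb hab => ?_⟩
  exact (Real.rpow_le_rpow (abs_nonneg _) (habs.2 (mem_univ x) (mem_univ y) ha hb hab)
    (by linarith)).trans
    ((convexOn_rpow hp).2 (abs_nonneg x) (abs_nonneg y) ha hb hab)

/-- Among comonotone splittings `L x = g x + (L x - g x)`, the centred part `g ∘ X` is dominated by
`L X` in the convex order. -/
theorem lintegral_convex_comp_sub_average_le {α : Type*} {m : MeasurableSpace α} {μ : Measure α}
    [IsFiniteMeasure μ] [NeZero μ] {f g : ℝ → ℝ} {X : α → ℝ} {L : ℝ} (hf : ConvexOn ℝ univ f)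
    (hf0 : ∀ t, 0 ≤ f t) (hfc : Continuous f) (hg : Monotone g) (hgc : Continuous g)
    (hgL : Monotone fun x => L * x - g x) (hX : Integrable X μ)
    (hgX : Integrable (fun a => g (X a)) μ) :
    ∫⁻ a, ENNReal.ofReal (f (g (X a) - ⨍ b, g (X b) ∂μ)) ∂μ ≤
      ∫⁻ a, ENNReal.ofReal (f (L * (X a - ⨍ b, X b ∂μ))) ∂μ := by
  set c := ⨍ b, g (X b) ∂μ with hc
  set e := ⨍ b, X b ∂μ with he
  have hH : Integrable (fun a => L * X a - g (X a)) μ := (hX.const_mul L).sub hgX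
  have hHavg : ⨍ a, (L * X a - g (X a)) ∂μ = L * e - c := by
    rw [hc, he, average_eq, average_eq, average_eq, integral_sub (hX.const_mul L) hgX,
      integral_const_mul]
    simp only [smul_eq_mul]
    ring
  -- Intermediate values: the mean of `h(X)` lies between two values of the continuous `h`. The
  -- point `x₀` need not be a value of `X`.
  obtain ⟨x₀, hx₀⟩ : ∃ x₀, L * x₀ - g x₀ = L * e - c := by
    obtain ⟨a, ha⟩ := exists_le_average (NeZero.ne μ) hH
    obtain ⟨b, hb⟩ := exists_average_le (NeZero.ne μ) hH
    rw [hHavg] at ha hb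
    exact mem_range_of_exists_le_of_exists_ge (f := fun x => L * x - g x) (by fun_prop)
      ⟨X a, ha⟩ ⟨X b, hb⟩
  obtain ⟨s, hs⟩ := hf.exists_slope_le_increment (g x₀ - c)
  set Z : α → ℝ := fun a => L * X a - g (X a) - (L * e - c) with hZ
  have hpt : ∀ a, f (g (X a) - c) + s * Z a ≤ f (L * (X a - e)) := by
    intro a
    -- The sign of `Z a` tells on which side of `x₀` the value `X a` lies, as `h` is monotone;
    -- monotonicity of `g` carries this over to `g (X a)` and `g x₀`.
    have h := hs (g (X a) - c) (Z a)
      (fun h => sub_le_sub_right (hg (hgL.reflect_lt (by simp only [hZ] at h ⊢; linarith)).le) c)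
      (fun h => sub_le_sub_right (hg (hgL.reflect_lt (by simp only [hZ] at h ⊢; linarith)).le) c)
    convert h using 2
    simp only [hZ]
    ring
  have hZi : Integrable Z μ := hH.sub (integrable_const _)
  have hZ0 : ∫ a, Z a ∂μ = 0 := by
    rw [hZ, ← hHavg]
    exact integral_sub_average μ _
  -- Only `X` is assumed integrable; if `f (L * (X - e))` is not, the right-hand side is `∞`.
  by_cases hF : Integrable (fun a => f (L * (X a - e))) μ
  · have hm : AEStronglyMeasurable (fun a => f (g (X a) - c)) μ :=
      hfc.comp_aestronglyMeasurable (hgX.1.sub aestronglyMeasurable_const)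
    have hG : Integrable (fun a => f (g (X a) - c)) μ := by
      refine Integrable.mono' (hF.sub (hZi.const_mul s)) hm (Filter.Eventually.of_forall fun a => ?_)
      rw [Real.norm_eq_abs, abs_of_nonneg (hf0 _), Pi.sub_apply]
      linarith [hpt a]
    rw [← ofReal_integral_eq_lintegral_ofReal hG (Filter.Eventually.of_forall fun a => hf0 _),
      ← ofReal_integral_eq_lintegral_ofReal hF (Filter.Eventually.of_forall fun a => hf0 _)]
    apply ENNReal.ofReal_le_ofReal
    have h := integral_mono (hG.add (hZi.const_mul s)) hF hpt
    simp only [Pi.add_apply] at h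
    rw [integral_add hG (hZi.const_mul s), integral_const_mul, hZ0] at h
    linarith
  · have hm : AEStronglyMeasurable (fun a => f (L * (X a - e))) μ :=
      hfc.comp_aestronglyMeasurable ((hX.1.sub aestronglyMeasurable_const).const_mul L)
    have htop : ∫⁻ a, ENNReal.ofReal (f (L * (X a - e))) ∂μ = ∞ := by
      by_contra hne
      exact hF ((lintegral_ofReal_ne_top_iff_integrable hm
        (Filter.Eventually.of_forall fun a => hf0 _)).1 hne)
    rw [htop]
    exact le_top

theorem abs_sub_le_lipConst_mul {g : ℝ → ℝ} (hL : lipConst g < ∞) (x y : ℝ) :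
    |g x - g y| ≤ (lipConst g).toReal * |x - y| := by
  rcases eq_or_ne x y with rfl | hxy
  · simp
  have h : ENNReal.ofReal (|g x - g y| / |x - y|) ≤ lipConst g :=
    le_iSup_of_le x (le_iSup_of_le y (le_iSup_of_le hxy le_rfl))
  rw [ENNReal.ofReal_le_iff_le_toReal hL.ne,
    div_le_iff₀ (abs_pos.2 (sub_ne_zero.2 hxy))] at h
  exact h

theorem continuous_of_lipConst_lt_top {g : ℝ → ℝ} (hL : lipConst g < ∞) : Continuous g :=
  (LipschitzWith.of_dist_le_mul (K := (lipConst g).toNNReal) fun x y => by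
    exact abs_sub_le_lipConst_mul hL x y).continuous

theorem monotone_lipConst_mul_sub {g : ℝ → ℝ} (hL : lipConst g < ∞) :
    Monotone fun x => (lipConst g).toReal * x - g x := by
  intro x y hxy
  have h := (le_abs_self _).trans (abs_sub_le_lipConst_mul hL y x)
  rw [abs_of_nonneg (sub_nonneg.2 hxy)] at h
  simp only
  linarith

theorem integrable_comp_of_lipConst_lt_top {α : Type*} {m : MeasurableSpace α} {μ : Measure α}
    [IsFiniteMeasure μ] {g : ℝ → ℝ} {X : α → ℝ} (hL : lipConst g < ∞) (hX : Integrable X μ) :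
    Integrable (fun a => g (X a)) μ := by
  refine Integrable.mono' ((hX.abs.const_mul (lipConst g).toReal).add (integrable_const |g 0|))
    ((continuous_of_lipConst_lt_top hL).comp_aestronglyMeasurable hX.1)
    (Filter.Eventually.of_forall fun a => ?_)
  have h₁ := abs_sub_le_lipConst_mul hL (X a) 0
  have h₂ := abs_sub_abs_le_abs_sub (g (X a)) (g 0)
  rw [sub_zero] at h₁
  simp only [Real.norm_eq_abs, Pi.add_apply]
  linarith

theorem volume_ne_zero_of_mem_boundedSubintervals {I J : Set ℝ} (hJ : J ∈ boundedSubintervals I) :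
    volume J ≠ 0 := by
  obtain ⟨-, hoc, -, hnt⟩ := hJ
  obtain ⟨a, ha, b, hb, hab⟩ := hnt.exists_lt
  refine fun h => absurd (measure_mono_null (hoc.out ha hb) h) ?_
  simp [hab]

theorem volume_ne_top_of_mem_boundedSubintervals {I J : Set ℝ} (hJ : J ∈ boundedSubintervals I) :
    volume J ≠ ∞ :=
  hJ.2.2.1.measure_lt_top.ne

theorem integrableOnSubintervals_comp {φ g : ℝ → ℝ} {I : Set ℝ} (hL : lipConst g < ∞)
    (hφ : IntegrableOnSubintervals φ I) : IntegrableOnSubintervals (fun x => g (φ x)) I := by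
  intro J hJ
  have : IsFiniteMeasure (volume.restrict J) :=
    isFiniteMeasure_restrict.2 (volume_ne_top_of_mem_boundedSubintervals hJ)
  exact integrable_comp_of_lipConst_lt_top hL (hφ J hJ)

theorem meanOsc_comp_le {p : ℝ} (hp : 1 ≤ p) {φ g : ℝ → ℝ} {J : Set ℝ} (hJ0 : volume J ≠ 0)
    (hJ : volume J ≠ ∞) (hφ : IntegrableOn φ J) (hg : Monotone g) (hL : lipConst g < ∞) :
    meanOsc p (fun x => g (φ x)) J ≤ lipConst g * meanOsc p φ J := by
  have hp0 : 0 < p := by linarith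
  have : IsFiniteMeasure (volume.restrict J) := isFiniteMeasure_restrict.2 hJ
  have : NeZero (volume.restrict J) := ⟨by rwa [Ne, Measure.restrict_eq_zero]⟩
  have h := lintegral_convex_comp_sub_average_le (convexOn_abs_rpow hp)
    (fun t => Real.rpow_nonneg (abs_nonneg t) p)
    (continuous_abs.rpow_const fun _ => Or.inr hp0.le) hg (continuous_of_lipConst_lt_top hL)
    (monotone_lipConst_mul_sub hL) hφ (integrable_comp_of_lipConst_lt_top hL hφ)
  have hscale : ∀ t : ℝ, ENNReal.ofReal (|(lipConst g).toReal * t| ^ p) =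
      lipConst g ^ p * ENNReal.ofReal (|t| ^ p) := by
    intro t
    rw [abs_mul, abs_of_nonneg ENNReal.toReal_nonneg,
      Real.mul_rpow ENNReal.toReal_nonneg (abs_nonneg t),
      ENNReal.ofReal_mul (Real.rpow_nonneg ENNReal.toReal_nonneg p),
      ← ENNReal.ofReal_rpow_of_nonneg ENNReal.toReal_nonneg hp0.le, ENNReal.ofReal_toReal hL.ne]
  simp only [hscale] at h
  rw [lintegral_const_mul' _ _ (ENNReal.rpow_ne_top_of_nonneg hp0.le hL.ne)] at h
  calc meanOsc p (fun x => g (φ x)) J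
      ≤ (lipConst g ^ p * ((volume J)⁻¹ *
          ∫⁻ x in J, ENNReal.ofReal (|φ x - ⨍ y in J, φ y| ^ p))) ^ (1 / p) := by
        refine ENNReal.rpow_le_rpow ?_ (by positivity)
        rw [mul_left_comm]
        gcongr
    _ = lipConst g * meanOsc p φ J := by
        rw [ENNReal.mul_rpow_of_nonneg _ _ (by positivity), ← ENNReal.rpow_mul,
          mul_one_div_cancel hp0.ne', ENNReal.rpow_one, meanOsc]

/-- Zero oscillation makes `φ` a.e. constant on `J`, so `g` may be arbitrary. This settles the
product `∞ * 0 = 0`. -/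
theorem meanOsc_comp_eq_zero {p : ℝ} (hp : 0 < p) {φ : ℝ → ℝ} (g : ℝ → ℝ) {J : Set ℝ}
    (hJ0 : volume J ≠ 0) (hJ : volume J ≠ ∞) (hφ : IntegrableOn φ J) (h0 : meanOsc p φ J = 0) :
    meanOsc p (fun x => g (φ x)) J = 0 := by
  have hc : ∀ᵐ x ∂volume.restrict J, φ x = ⨍ y in J, φ y := by
    rw [meanOsc, ENNReal.rpow_eq_zero_iff_of_pos (by positivity), mul_eq_zero,
      ENNReal.inv_eq_zero, or_iff_right hJ, lintegral_eq_zero_iff'] at h0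
    · filter_upwards [h0] with x hx
      have hx' : |φ x - ⨍ y in J, φ y| ^ p ≤ 0 := ENNReal.ofReal_eq_zero.1 hx
      have := (Real.rpow_eq_zero (abs_nonneg _) hp.ne').1
        (le_antisymm hx' (Real.rpow_nonneg (abs_nonneg _) p))
      exact sub_eq_zero.1 (abs_eq_zero.1 this)
    · exact (((hφ.1.aemeasurable.sub_const _).abs).pow_const p).ennreal_ofReal
  have : IsFiniteMeasure (volume.restrict J) := isFiniteMeasure_restrict.2 hJ
  have : NeZero (volume.restrict J) := ⟨by rwa [Ne, Measure.restrict_eq_zero]⟩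
  have hgc : (fun x => g (φ x)) =ᵐ[volume.restrict J] fun _ => g (⨍ y in J, φ y) := by
    filter_upwards [hc] with x hx using congrArg g hx
  rw [meanOsc, average_congr hgc, average_const, lintegral_congr_ae (g := 0)]
  · simp [hp]
  · filter_upwards [hgc] with x hx
    simp [hx, Real.zero_rpow hp.ne']

theorem bmoNorm_comp_le {p : ℝ} (hp : 1 ≤ p) {I : Set ℝ} {φ g : ℝ → ℝ}
    (hφ : IntegrableOnSubintervals φ I) (hg : Monotone g) :
    bmoNorm p I (fun x => g (φ x)) ≤ lipConst g * bmoNorm p I φ := by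
  have hle : ∀ J ∈ boundedSubintervals I, meanOsc p φ J ≤ bmoNorm p I φ :=
    fun J hJ => le_iSup₂_of_le J hJ le_rfl
  refine iSup₂_le fun J hJ => ?_
  have hJ0 := volume_ne_zero_of_mem_boundedSubintervals hJ
  have hJt := volume_ne_top_of_mem_boundedSubintervals hJ
  rcases eq_or_ne (bmoNorm p I φ) 0 with h0 | h0
  · rw [meanOsc_comp_eq_zero (by linarith) g hJ0 hJt (hφ J hJ)
      (le_antisymm ((hle J hJ).trans h0.le) zero_le)]
    exact zero_le
  -- The seminorm is now nonzero, so an infinite Lipschitz constant makes the bound `∞`.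
  rcases eq_or_ne (lipConst g) ∞ with hL | hL
  · rw [hL, ENNReal.top_mul h0]
    exact le_top
  · exact (meanOsc_comp_le hp hJ0 hJt (hφ J hJ) hg hL.lt_top).trans (by gcongr; exact hle J hJ)

theorem lipConst_min_le_one (N : ℝ) : lipConst (fun x => min x N) ≤ 1 := by
  refine iSup_le fun x => iSup_le fun y => iSup_le fun hxy => ?_
  rw [ENNReal.ofReal_le_one, div_le_one (abs_pos.2 (sub_ne_zero.2 hxy))]
  simpa using abs_min_sub_min_le_max x N y N

theorem mainTheorem7 (p : ℝ) (hp : 1 ≤ p) (I : Set ℝ) (hI : I.OrdConnected)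
    (φ : ℝ → ℝ) (hφ : IntegrableOnSubintervals φ I) :
    (∀ g : ℝ → ℝ, Monotone g →
      (lipConst g < ∞ → IntegrableOnSubintervals (fun x => g (φ x)) I) ∧
      bmoNorm p I (fun x => g (φ x)) ≤ lipConst g * bmoNorm p I φ) ∧
    (∀ N : ℝ,
      IntegrableOnSubintervals (fun x => min (φ x) N) I ∧
      bmoNorm p I (fun x => min (φ x) N) ≤ bmoNorm p I φ) := by
  refine ⟨fun g hg => ⟨fun hL => integrableOnSubintervals_comp hL hφ, bmoNorm_comp_le hp hφ hg⟩,
    fun N => ⟨?_, ?_⟩⟩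
  · exact integrableOnSubintervals_comp (g := fun x => min x N)
      ((lipConst_min_le_one N).trans_lt ENNReal.one_lt_top) hφ
  · calc bmoNorm p I (fun x => min (φ x) N)
        ≤ lipConst (fun x => min x N) * bmoNorm p I φ :=
          bmoNorm_comp_le (g := fun x => min x N) hp hφ
            fun _ _ h => min_le_min_right N h
      _ ≤ 1 * bmoNorm p I φ := by gcongr; exact lipConst_min_le_one N
      _ = bmoNorm p I φ := one_mul _
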